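/- Let $\mathbb F$ be an algebraically closed field of characteristic different from $2$ and $3$. A Jacobi–Jordan (JJ) algebra over $\mathbb F$ is an $\mathbb F$-vector space $\mathfrak J$ with a bilinear product satisfying $x\cdot y=y\cdot x$ and $x\cdot(y\cdot z)+y\cdot(z\cdot x)+z\cdot(x\cdot y)=0$; it is nontrivial if its product is not identically zero. A symplectic JJ algebra is a pair $(\mathfrak J,\omega)$ with $\omega$ a non-degenerate skew-symmetric bilinear form such that $\omega(x\cdot y,z)+\omega(y\cdot z,x)+\omega(z\cdot x,y)=0$; a pseudo-euclidean JJ algebra is a pair $(\mathfrak J,B)$ with $B$ a non-degenerate symmetric bilinear form such that $B(x\cdot y,z)=B(x,y\cdot z)$. Such a pair is indecomposable if $\mathfrak J\neq0$ and the only ideals of $\mathfrak J$ on which the form restricts to a non-degenerate form are $0$ and $\mathfrak J$. Two such pairs are isometrically isomorphic if there is an algebra isomorphism between them that preserves the forms. Let $\mathfrak J_{1,2}$ be the commutative algebra with basis $e_1,e_2$ and only nonzero product $e_1^2=e_2$, and let $\mathfrak J_{1,4}$ be the commutative algebra with basis $e_1,\dots,e_4$ and only nonzero products $e_1^2=e_2$,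 $e_1\cdot e_3=e_3\cdot e_1=e_4$. **Theorem.** $\mathfrak J_{1,2}$ and $\mathfrak J_{1,4}$ are nontrivial JJ algebras, and the following hold. (1) With the form whose matrix in the basis $e_1,\dots,e_4$ is $$\omega_{\mathfrak J_{1,4}}=\begin{pmatrix}0&0&0&1\\0&0&2&0\\0&-2&0&0\\-1&0&0&0\end{pmatrix},$$ $\mathfrak J_{1,4}$ is an indecomposable symplectic JJ algebra. Every nontrivial indecomposable symplectic JJ algebra of dimension at most $5$ is isometrically isomorphic to $(\mathfrak J_{1,4},\omega_{\mathfrak J_{1,4}})$ (in particular its underlying algebra is isomorphic to $\mathfrak J_{1,4}$). (2) With the forms whose matrices in the bases $e_1,e_2$ and $e_1,\dots,e_4$ are $$B_{\mathfrak J_{1,2}}=\begin{pmatrix}0&1\\1&0\end{pmatrix},\qquad B_{\mathfrak J_{1,4}}=\begin{pmatrix}0&0&0&1\\0&0&1&0\\0&1&0&0\\1&0&0&0\end{pmatrix},$$ $\mathfrak J_{1,2}$ and $\mathfrak J_{1,4}$ are indecomposable pseudo-euclidean JJ algebras. The algebras $\mathfrak J_{1,2}$ and $\mathfrak J_{1,4}$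 are not isomorphic, and every nontrivial indecomposable pseudo-euclidean JJ algebra of dimension at most $5$ is isometrically isomorphic to $(\mathfrak J_{1,2},B_{\mathfrak J_{1,2}})$ or to $(\mathfrak J_{1,4},B_{\mathfrak J_{1,4}})$ (in particular its underlying algebra is isomorphic to $\mathfrak J_{1,2}$ or $\mathfrak J_{1,4}$). -/

import Mathlib

open Module

universe u v w

section Algebras

variable (F : Type u) (J : Type v) [Field F] [NonUnitalNonAssocRing J]

/-- Jacobi-Jordan algebras: a (not necessarily associative) algebra whose product is commutative
and satisfies the Jacobi identity. -/
structure IsJacobiJordan : Prop where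
  mul_comm : ∀ x y : J, x * y = y * x
  jacobi : ∀ x y z : J, x * (y * z) + y * (z * x) + z * (x * y) = 0

/-- The algebra is nontrivial: its product is not identically zero. -/
def HasNontrivialProduct : Prop := ∃ x y : J, x * y ≠ 0

variable {F J} [Module F J]

/-- A linear subspace which is a (two-sided) ideal of the algebra. -/
def IsAlgebraIdeal (I : Submodule F J) : Prop :=
  ∀ x : J, ∀ y ∈ I, x * y ∈ I ∧ y * x ∈ I

/-- Symplectic forms on an algebra: non-degenerate, skew-symmetric and closed. -/
structure IsSymplecticForm (ω : LinearMap.BilinForm F J) : Prop where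
  nondegenerate : ω.Nondegenerate
  skew : ∀ x y : J, ω x y = -ω y x
  closed : ∀ x y z : J, ω (x * y) z + ω (y * z) x + ω (z * x) y = 0

/-- Pseudo-euclidean forms on an algebra: non-degenerate, symmetric and invariant. -/
structure IsPseudoEuclideanForm (B : LinearMap.BilinForm F J) : Prop where
  nondegenerate : B.Nondegenerate
  symm : ∀ x y : J, B x y = B y x
  invariant : ∀ x y z : J, B (x * y) z = B x (y * z)

/-- An algebra with a form is indecomposable if it is nonzero and has no ideal, besides `0` and
the whole algebra, on which the form restricts to a non-degenerate form. -/
def IsIndecomposable (B : LinearMap.BilinForm F J) : Prop :=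
  Nontrivial J ∧
    ∀ I : Submodule F J, IsAlgebraIdeal I → (B.restrict I).Nondegenerate → I = ⊥ ∨ I = ⊤

/-- Two algebras with a form are isometrically isomorphic: there is a linear bijection which
respects the products and the forms. -/
def IsometricallyIsomorphic {J' : Type w} [NonUnitalNonAssocRing J'] [Module F J']
    (B : LinearMap.BilinForm F J) (B' : LinearMap.BilinForm F J') : Prop :=
  ∃ f : J ≃ₗ[F] J', (∀ x y : J, f (x * y) = f x * f y) ∧ ∀ x y : J, B' (f x) (f y) = B x y

end Algebras

/-! ### The algebra with basis `e₁, e₂` and `e₁² = e₂` -/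

/-- The two-dimensional algebra with basis `e₁, e₂` and the only nonzero product `e₁ e₁ = e₂`. -/
def J12 (F : Type u) : Type u := Fin 2 → F

namespace J12

variable {F : Type u} [Field F]

instance : NonUnitalNonAssocRing (J12 F) :=
  { (inferInstanceAs (AddCommGroup (Fin 2 → F)) : AddCommGroup (J12 F)) with
    mul := fun x y => ![0, x 0 * y 0]
    left_distrib := fun x y z => by
      change (![0, x 0 * (y 0 + z 0)] : Fin 2 → F) = ![0, x 0 * y 0] + ![0, x 0 * z 0]
      funext i
      fin_cases i <;> simp <;> ring
    right_distrib := fun x y z => by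
      change (![0, (x 0 + y 0) * z 0] : Fin 2 → F) = ![0, x 0 * z 0] + ![0, y 0 * z 0]
      funext i
      fin_cases i <;> simp <;> ring
    zero_mul := fun x => by
      change (![0, (0 : F) * x 0] : Fin 2 → F) = 0
      funext i
      fin_cases i <;> simp
    mul_zero := fun x => by
      change (![0, x 0 * (0 : F)] : Fin 2 → F) = 0
      funext i
      fin_cases i <;> simp }

instance : Module F (J12 F) := inferInstanceAs (Module F (Fin 2 → F))

instance : IsScalarTower F (J12 F) (J12 F) where
  smul_assoc c x y := by
    change (![0, (c * x 0) * y 0] : Fin 2 → F) = c • ![0, x 0 * y 0]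
    funext i
    fin_cases i <;> simp <;> ring

instance : SMulCommClass F (J12 F) (J12 F) where
  smul_comm c x y := by
    change c • (![0, x 0 * y 0] : Fin 2 → F) = ![0, x 0 * (c * y 0)]
    funext i
    fin_cases i <;> simp <;> ring

variable (F)

/-- The coordinates with respect to `e₁, e₂`. -/
def coords : J12 F ≃ₗ[F] (Fin 2 → F) where
  toFun x := x
  invFun x := x
  map_add' _ _ := rfl
  map_smul' _ _ := rfl

theorem coords_mul (x y : J12 F) : coords F (x * y) =
      ![0, coords F x 0 * coords F y 0] := rfl

/-- The basis `e₁, e₂` (indexed by `0, 1`). -/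
noncomputable def basis : Basis (Fin 2) F (J12 F) :=
  Basis.ofEquivFun (coords F)

/-- The pseudo-euclidean form, given by its matrix in the basis `e₁, e₂`. -/
noncomputable def pseudoEuclideanForm : LinearMap.BilinForm F (J12 F) :=
  Matrix.toBilin (basis F) !![0, 1; 1, 0]

theorem coords_basis (i : Fin 2) : coords F (basis F i) = Pi.single i 1 := by
  rw [basis, Basis.coe_ofEquivFun, LinearEquiv.apply_symm_apply]

/-- The multiplication table: `e₁ e₁ = e₂` and the other products of basis vectors vanish. -/
theorem basis_mul_basis (i j : Fin 2) :
    basis F i * basis F j = if i = 0 ∧ j = 0 then basis F 1 else 0 := by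
  apply (coords F).injective
  rw [coords_mul, coords_basis, coords_basis]
  funext k
  fin_cases i <;> fin_cases j <;> fin_cases k <;>
    simp [coords_basis]

end J12

/-! ### The algebra with basis `e₁, e₂, e₃, e₄`, `e₁² = e₂` and `e₁ e₃ = e₄` -/

/-- The four-dimensional commutative algebra with basis `e₁, e₂, e₃, e₄` and the nonzero products
`e₁ e₁ = e₂` and `e₁ e₃ = e₃ e₁ = e₄`. -/
def J14 (F : Type u) : Type u := Fin 4 → F

namespace J14

variable {F : Type u} [Field F]

instance : NonUnitalNonAssocRing (J14 F) :=
  { (inferInstanceAs (AddCommGroup (Fin 4 → F)) : AddCommGroup (J14 F)) with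
    mul := fun x y => ![0, x 0 * y 0, 0, x 0 * y 2 + x 2 * y 0]
    left_distrib := fun x y z => by
      change (![0, x 0 * (y 0 + z 0), 0, x 0 * (y 2 + z 2) + x 2 * (y 0 + z 0)] : Fin 4 → F) = ![0, x 0 * y 0, 0, x 0 * y 2 + x 2 * y 0] + ![0, x 0 * z 0, 0, x 0 * z 2 + x 2 * z 0]
      funext i
      fin_cases i <;> simp <;> ring
    right_distrib := fun x y z => by
      change (![0, (x 0 + y 0) * z 0, 0, (x 0 + y 0) * z 2 + (x 2 + y 2) * z 0] : Fin 4 → F) = ![0, x 0 * z 0, 0, x 0 * z 2 + x 2 * z 0] + ![0, y 0 * z 0, 0, y 0 * z 2 + y 2 * z 0]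
      funext i
      fin_cases i <;> simp <;> ring
    zero_mul := fun x => by
      change (![0, (0 : F) * x 0, 0, (0 : F) * x 2 + (0 : F) * x 0] : Fin 4 → F) = 0
      funext i
      fin_cases i <;> simp
    mul_zero := fun x => by
      change (![0, x 0 * (0 : F), 0, x 0 * (0 : F) + x 2 * (0 : F)] : Fin 4 → F) = 0
      funext i
      fin_cases i <;> simp }

instance : Module F (J14 F) := inferInstanceAs (Module F (Fin 4 → F))

instance : IsScalarTower F (J14 F) (J14 F) where
  smul_assoc c x y := by
    change (![0, (c * x 0) * y 0, 0, (c * x 0) * y 2 + (c * x 2) * y 0] : Fin 4 → F) = c • ![0, x 0 * y 0, 0, x 0 * y 2 + x 2 * y 0]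
    funext i
    fin_cases i <;> simp <;> ring

instance : SMulCommClass F (J14 F) (J14 F) where
  smul_comm c x y := by
    change c • (![0, x 0 * y 0, 0, x 0 * y 2 + x 2 * y 0] : Fin 4 → F) = ![0, x 0 * (c * y 0), 0, x 0 * (c * y 2) + x 2 * (c * y 0)]
    funext i
    fin_cases i <;> simp <;> ring

variable (F)

/-- The coordinates with respect to `e₁, e₂, e₃, e₄`. -/
def coords : J14 F ≃ₗ[F] (Fin 4 → F) where
  toFun x := x
  invFun x := x
  map_add' _ _ := rfl
  map_smul' _ _ := rfl

theorem coords_mul (x y : J14 F) : coords F (x * y) =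
      ![0, coords F x 0 * coords F y 0, 0,
        coords F x 0 * coords F y 2 + coords F x 2 * coords F y 0] := rfl

/-- The basis `e₁, e₂, e₃, e₄` (indexed by `0, 1, 2, 3`). -/
noncomputable def basis : Basis (Fin 4) F (J14 F) :=
  Basis.ofEquivFun (coords F)

/-- The symplectic form, given by its matrix in the basis `e₁, e₂, e₃, e₄`. -/
noncomputable def symplecticForm : LinearMap.BilinForm F (J14 F) :=
  Matrix.toBilin (basis F) !![0, 0, 0, 1; 0, 0, 2, 0; 0, -2, 0, 0; -1, 0, 0, 0]

/-- The pseudo-euclidean form, given by its matrix in the basis `e₁, e₂, e₃, e₄`. -/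
noncomputable def pseudoEuclideanForm : LinearMap.BilinForm F (J14 F) :=
  Matrix.toBilin (basis F) !![0, 0, 0, 1; 0, 0, 1, 0; 0, 1, 0, 0; 1, 0, 0, 0]

theorem coords_basis (i : Fin 4) : coords F (basis F i) = Pi.single i 1 := by
  rw [basis, Basis.coe_ofEquivFun, LinearEquiv.apply_symm_apply]

/-- The multiplication table: `e₁ e₁ = e₂`, `e₁ e₃ = e₃ e₁ = e₄`, and the other products of basis
vectors vanish. -/
theorem basis_mul_basis (i j : Fin 4) :
    basis F i * basis F j = if i = 0 ∧ j = 0 then basis F 1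
      else if (i = 0 ∧ j = 2) ∨ (i = 2 ∧ j = 0) then basis F 3 else 0 := by
  apply (coords F).injective
  rw [coords_mul, coords_basis, coords_basis]
  funext k
  fin_cases i <;> fin_cases j <;> fin_cases k <;>
    simp [coords_basis]

end J14

/-! Write `L_x` for multiplication by `x`. The Jacobi identity, in characteristic other than 2 and
3, gives `x * (x * x) = 0`, `L_{x²} = -2 L_x²` and `L_x³ = 0`. So multiplications have no nonzero
eigenvalue, and the algebra is nilpotent of class two (all threefold products vanish) as soon as
every `L_x²` is zero. Proving this in small dimension is the main work: a nonzero `L_x²` produces so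
many independent vectors that they span the algebra, and expanding `x` in them is contradictory.

Once the class is two, products annihilate the algebra and are isotropic for either form. Everything
is then governed by the values of the form on a product and a generator, and adding products to
generators corrects the form between the generators without changing any product.

Symplectic case: a nondegenerate skew form forces even dimension, so the dimension is at most 4.
Closedness gives `ω (x * x) x = 0` and `ω (x * y) x = -ω (x * x) y / 2`. A nonzero square then
yields four independent vectors `x, x * x, y, x * y`, and rescaling gives the model.

Pseudo-euclidean case: `T(x, y, z) = B (x * y) z` is a symmetric trilinear form whose radical is the
annihilator `A`. Indecomposability makes `A` isotropic, and class two together with invariance gives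
`A = A^⊥`, so the dimension is `2 * dim A`, that is 2 or 4. The algebra is therefore encoded by a
cubic form without radical on the quotient by `A`. In one variable it is a cube, giving `J12`. In
two variables over an algebraically closed field it is equivalent either to `s² t`, giving `J14`, or
to `s³ + t³`, which splits the algebra into two orthogonal ideals. -/

/-! ### Linear independence from Gram matrices -/

section Gram

variable {F : Type u} {V : Type v} [Field F] [AddCommGroup V] [Module F V]

/-- A family whose mutual Gram matrix with some other family is lower triangular with nonzero
diagonal is linearly independent. -/
theorem linearIndependent_of_gram_triangular {n : ℕ} (B : LinearMap.BilinForm F V)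
    (w v : Fin n → V) (hlt : ∀ i j, i < j → B (w i) (v j) = 0)
    (hdiag : ∀ i, B (w i) (v i) ≠ 0) : LinearIndependent F v := by
  set M : Matrix (Fin n) (Fin n) F := Matrix.of fun i j => B (w i) (v j) with hM
  have hdet : M.det ≠ 0 := by
    rw [Matrix.det_of_isLowerTriangular M fun i j hij => hlt i j hij]
    exact Finset.prod_ne_zero_iff.2 fun i _ => hdiag i
  rw [Fintype.linearIndependent_iff]
  intro g hg
  have : g = 0 := by
    apply Matrix.eq_zero_of_mulVec_eq_zero hdet
    funext i
    have := congrArg (B (w i)) hg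
    simpa [hM, Matrix.mulVec, dotProduct, map_sum, mul_comm] using this
  intro i
  rw [this]; rfl

/-- A vector orthogonal to a spanning family is zero. -/
theorem eq_zero_of_forall_basis {ι : Type*} {B : LinearMap.BilinForm F V} (hB : B.Nondegenerate)
    (b : Basis ι F V) {x : V} (h : ∀ i, B x (b i) = 0) : x = 0 := by
  apply hB.1
  intro y
  have : B x = 0 := b.ext (by simpa using h)
  simp [this]

/-- A family with the same Gram matrix as a basis of a non-degenerate space is linearly
independent. -/
theorem linearIndependent_of_gram_eq {ι : Type*} [Fintype ι] {V' : Type w} [AddCommGroup V']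
    [Module F V'] {B : LinearMap.BilinForm F V} {B' : LinearMap.BilinForm F V'}
    (hB' : B'.Nondegenerate) (b : Basis ι F V') (v : ι → V)
    (h : ∀ i j, B (v i) (v j) = B' (b i) (b j)) : LinearIndependent F v := by
  rw [Fintype.linearIndependent_iff]
  intro g hg
  have : ∑ i, g i • b i = 0 := eq_zero_of_forall_basis hB' b fun j => by
    have := congrArg (B · (v j)) hg
    simpa [map_sum, LinearMap.sum_apply, h] using this
  exact Fintype.linearIndependent_iff.1 b.linearIndependent g this

/-- A space with a non-degenerate skew-symmetric form is even-dimensional. -/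
theorem even_finrank_of_skew [Module.Finite F V] (h2 : (2 : F) ≠ 0) {B : LinearMap.BilinForm F V}
    (hB : B.Nondegenerate) (hskew : ∀ x y, B x y = -B y x) : Even (finrank F V) := by
  let b := finBasis F V
  have hdet : (LinearMap.BilinForm.toMatrix b B).det ≠ 0 :=
    (LinearMap.BilinForm.nondegenerate_iff_det_ne_zero b).1 hB
  by_contra hodd
  rw [Nat.not_even_iff_odd] at hodd
  -- In odd size, a matrix with `Mᵀ = -M` has `det M = -det M`.
  have htr : (LinearMap.BilinForm.toMatrix b B).transpose = -LinearMap.BilinForm.toMatrix b B := by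
    ext i j
    rw [Matrix.transpose_apply, Matrix.neg_apply, LinearMap.BilinForm.toMatrix_apply,
      LinearMap.BilinForm.toMatrix_apply, hskew]
  have h := congrArg Matrix.det htr
  rw [Matrix.det_transpose, Matrix.det_neg, Fintype.card_fin, hodd.neg_one_pow] at h
  apply hdet
  have : (2 : F) * (LinearMap.BilinForm.toMatrix b B).det = 0 := by linear_combination h
  simpa [h2] using this

end Gram

/-! ### Identities in Jacobi-Jordan algebras -/

section Identities

variable {F : Type u} {J : Type v} [Field F] [NonUnitalNonAssocRing J] [Module F J]

namespace IsJacobiJordan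

variable (F) in
theorem mul_mul_self (h : IsJacobiJordan J) (h3 : (3 : F) ≠ 0) (x : J) : x * (x * x) = 0 := by
  have h1 := h.jacobi x x x
  have : (3 : F) • (x * (x * x)) = 0 := by linear_combination (norm := module) h1
  exact (smul_eq_zero.1 this).resolve_left h3

-- The Jacobi identity for `x, x, y`. It turns statements about squares into statements about
-- `L_x²`.
variable (F) in
theorem sq_mul (h : IsJacobiJordan J) (x y : J) : x * x * y = (-2 : F) • (x * (x * y)) := by
  have h1 := h.jacobi x x y
  rw [h.mul_comm y x, h.mul_comm y (x * x)] at h1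
  linear_combination (norm := module) h1

variable [SMulCommClass F J J]

-- In the Jacobi identity for `x, x * x, y` the term with `x * (x * x)` drops out, and each of the
-- other two equals `-2 L_x³ y`.
variable (F) in
theorem mul_mul_mul (h : IsJacobiJordan J) (h2 : (2 : F) ≠ 0) (h3 : (3 : F) ≠ 0) (x y : J) :
    x * (x * (x * y)) = 0 := by
  have h1 := h.jacobi x (x * x) y
  rw [h.mul_comm y (x * (x * x)), h.mul_mul_self F h3, zero_mul, h.mul_comm y x, h.sq_mul F x y,
    h.sq_mul F x (x * y), mul_smul_comm] at h1
  have : (4 : F) • (x * (x * (x * y))) = 0 := by linear_combination (norm := module) -h1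
  refine (smul_eq_zero.1 this).resolve_left ?_
  have : (4 : F) = 2 * 2 := by norm_num
  rw [this]; exact mul_ne_zero h2 h2

/-- Multiplication operators have no nonzero eigenvalues. -/
theorem eigenvalue_eq_zero (h : IsJacobiJordan J) (h2 : (2 : F) ≠ 0) (h3 : (3 : F) ≠ 0) {x y : J}
    {c : F} (hy : y ≠ 0) (hxy : x * y = c • y) : c = 0 := by
  have h1 := h.mul_mul_mul F h2 h3 x y
  simp only [hxy, mul_smul_comm, smul_smul] at h1
  simpa using (smul_eq_zero.1 h1).resolve_right hy

end IsJacobiJordan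

end Identities

/-! ### The model algebras -/

namespace J12

variable {F : Type u} [Field F]

theorem ext {x y : J12 F} (h0 : coords F x 0 = coords F y 0) (h1 : coords F x 1 = coords F y 1) :
    x = y := by
  apply (coords F).injective
  funext i
  fin_cases i <;> assumption

theorem isJacobiJordan : IsJacobiJordan (J12 F) where
  mul_comm x y := by apply ext <;> simp [coords_mul, mul_comm]
  jacobi x y z := by apply ext <;> simp [coords_mul]

theorem hasNontrivialProduct : HasNontrivialProduct (J12 F) := by
  refine ⟨basis F 0, basis F 0, ?_⟩
  rw [basis_mul_basis]
  simpa using (basis F).ne_zero 1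

theorem pseudoEuclideanForm_apply (x y : J12 F) : pseudoEuclideanForm F x y =
    coords F x 0 * coords F y 1 + coords F x 1 * coords F y 0 := by
  simp [pseudoEuclideanForm, Matrix.toBilin_apply, basis, Fin.sum_univ_two]

theorem isPseudoEuclideanForm : IsPseudoEuclideanForm (pseudoEuclideanForm F) := by
  have symm : ∀ x y, pseudoEuclideanForm F x y = pseudoEuclideanForm F y x := fun x y => by
    simp only [pseudoEuclideanForm_apply]; ring
  have sep : ∀ x, (∀ y, pseudoEuclideanForm F x y = 0) → x = 0 := fun x hx => by
    have h0 := hx (basis F 0)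
    have h1 := hx (basis F 1)
    simp [pseudoEuclideanForm_apply, coords_basis] at h0 h1
    apply ext <;> simpa
  refine ⟨⟨sep, fun y hy => sep y fun x => by rw [symm, hy]⟩, symm, fun x y z => ?_⟩
  simp [pseudoEuclideanForm_apply, coords_mul]
  ring

instance : Nontrivial (J12 F) := ⟨basis F 0, 0, (basis F).ne_zero 0⟩

/-- An ideal inside the hyperplane of zero first coordinate is totally isotropic, hence zero; any
other ideal contains `e₂`, hence everything. -/
theorem isIndecomposable : IsIndecomposable (pseudoEuclideanForm F) := by
  refine ⟨inferInstance, fun I hI hnd => ?_⟩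
  by_cases h : ∀ x ∈ I, coords F x 0 = 0
  · left
    rw [Submodule.eq_bot_iff]
    intro x hx
    have := hnd.1 ⟨x, hx⟩ fun y => by
      simp [pseudoEuclideanForm_apply, h x hx, h y.1 y.2]
    exact congrArg Subtype.val this
  · right
    push Not at h
    obtain ⟨x, hx, hx0⟩ := h
    have h1 : basis F 1 ∈ I := by
      have : basis F 1 = (coords F x 0)⁻¹ • (basis F 0 * x) := by
        apply ext <;> simp [coords_mul, coords_basis, hx0]
      rw [this]
      exact I.smul_mem _ (hI _ _ hx).1
    rw [eq_top_iff]
    intro y _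
    have : y = (coords F y 0 / coords F x 0) • x +
        (coords F y 1 - coords F y 0 / coords F x 0 * coords F x 1) • basis F 1 := by
      apply ext <;> simp [coords_basis, hx0]
    rw [this]
    exact I.add_mem (I.smul_mem _ hx) (I.smul_mem _ h1)

theorem finrank_eq : finrank F (J12 F) = 2 := by
  rw [finrank_eq_card_basis (basis F), Fintype.card_fin]

/-- An algebra with a form and a basis in which products and form are those of `J12`. -/
theorem isometricallyIsomorphic_of_basis {J : Type v} [NonUnitalNonAssocRing J] [Module F J]
    [IsScalarTower F J J] [SMulCommClass F J J] {B : LinearMap.BilinForm F J}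
    {B' : LinearMap.BilinForm F (J12 F)} (b : Basis (Fin 2) F J)
    (hmul : ∀ i j, b i * b j = if i = 0 ∧ j = 0 then b 1 else 0)
    (hform : ∀ i j, B (b i) (b j) = B' (basis F i) (basis F j)) :
    IsometricallyIsomorphic B B' := by
  let f := b.equiv (basis F) (Equiv.refl _)
  have hf : ∀ i, f (b i) = basis F i := fun i => by simp [f]
  refine ⟨f, fun x y => ?_, fun x y => ?_⟩
  · have : (LinearMap.mul F J).compr₂ f.toLinearMap =
        (LinearMap.mul F (J12 F)).compl₁₂ f.toLinearMap f.toLinearMap := by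
      refine b.ext fun i => b.ext fun j => ?_
      simp only [LinearMap.compr₂_apply, LinearMap.compl₁₂_apply, LinearMap.mul_apply',
        LinearEquiv.coe_coe, hf, basis_mul_basis, hmul]
      split_ifs <;> simp [hf]
    exact LinearMap.congr_fun₂ this x y
  · have : B'.compl₁₂ f.toLinearMap f.toLinearMap = B := by
      refine b.ext fun i => b.ext fun j => ?_
      simp only [LinearMap.compl₁₂_apply, LinearEquiv.coe_coe, hf, hform]
    exact LinearMap.congr_fun₂ this x y

/-- The isometry with `J12` determined by an element which plays the role of `e₁`. -/
theorem isometricallyIsomorphic_of_generator {J : Type v} [NonUnitalNonAssocRing J] [Module F J]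
    [IsScalarTower F J J] [SMulCommClass F J J] {B : LinearMap.BilinForm F J}
    {B' : LinearMap.BilinForm F (J12 F)} (hB' : B'.Nondegenerate)
    (hn : finrank F J = 2) (hcomm : ∀ x y : J, x * y = y * x) (hcl : ∀ x y z : J, x * y * z = 0)
    (x : J) (hform : ∀ i j, B (![x, x * x] i) (![x, x * x] j) = B' (basis F i) (basis F j)) :
    IsometricallyIsomorphic B B' := by
  have hli : LinearIndependent F ![x, x * x] :=
    linearIndependent_of_gram_eq hB' (basis F) _ hform
  let b := basisOfLinearIndependentOfCardEqFinrank hli (by simp [hn])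
  have hb : ⇑b = ![x, x * x] := coe_basisOfLinearIndependentOfCardEqFinrank _ _
  refine isometricallyIsomorphic_of_basis b (fun i j => ?_) (by simpa only [hb] using hform)
  rw [hb]
  fin_cases i <;> fin_cases j <;> simp [hcl, hcomm x (x * x)]

end J12

namespace J14

variable {F : Type u} [Field F]

theorem ext {x y : J14 F} (h0 : coords F x 0 = coords F y 0) (h1 : coords F x 1 = coords F y 1)
    (h2 : coords F x 2 = coords F y 2) (h3 : coords F x 3 = coords F y 3) : x = y := by
  apply (coords F).injective
  funext i
  fin_cases i <;> assumption

theorem isJacobiJordan : IsJacobiJordan (J14 F) where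
  mul_comm x y := by apply ext <;> simp [coords_mul, mul_comm, add_comm]
  jacobi x y z := by apply ext <;> simp [coords_mul]

theorem hasNontrivialProduct : HasNontrivialProduct (J14 F) := by
  refine ⟨basis F 0, basis F 0, ?_⟩
  rw [basis_mul_basis]
  simpa using (basis F).ne_zero 1

theorem pseudoEuclideanForm_apply (x y : J14 F) : pseudoEuclideanForm F x y =
    coords F x 0 * coords F y 3 + coords F x 1 * coords F y 2 + coords F x 2 * coords F y 1 +
      coords F x 3 * coords F y 0 := by
  simp [pseudoEuclideanForm, Matrix.toBilin_apply, basis, Fin.sum_univ_four]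

theorem symplecticForm_apply (x y : J14 F) : symplecticForm F x y =
    coords F x 0 * coords F y 3 + 2 * coords F x 1 * coords F y 2 +
      (-2) * coords F x 2 * coords F y 1 + (-1) * coords F x 3 * coords F y 0 := by
  simp [symplecticForm, Matrix.toBilin_apply, basis, Fin.sum_univ_four]
  ring

theorem isPseudoEuclideanForm : IsPseudoEuclideanForm (pseudoEuclideanForm F) := by
  have symm : ∀ x y, pseudoEuclideanForm F x y = pseudoEuclideanForm F y x := fun x y => by
    simp only [pseudoEuclideanForm_apply]; ring
  have sep : ∀ x, (∀ y, pseudoEuclideanForm F x y = 0) → x = 0 := fun x hx => by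
    have h0 := hx (basis F 0)
    have h1 := hx (basis F 1)
    have h2 := hx (basis F 2)
    have h3 := hx (basis F 3)
    simp [pseudoEuclideanForm_apply, coords_basis] at h0 h1 h2 h3
    apply ext <;> simpa
  refine ⟨⟨sep, fun y hy => sep y fun x => by rw [symm, hy]⟩, symm, fun x y z => ?_⟩
  simp [pseudoEuclideanForm_apply, coords_mul]
  ring

theorem isSymplecticForm (htwo : (2 : F) ≠ 0) : IsSymplecticForm (symplecticForm F) := by
  have skew : ∀ x y, symplecticForm F x y = -symplecticForm F y x := fun x y => by
    simp only [symplecticForm_apply]; ring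
  have sep : ∀ x, (∀ y, symplecticForm F x y = 0) → x = 0 := fun x hx => by
    have h0 := hx (basis F 0)
    have h1 := hx (basis F 1)
    have h2 := hx (basis F 2)
    have h3 := hx (basis F 3)
    simp [symplecticForm_apply, coords_basis, htwo] at h0 h1 h2 h3
    apply ext <;> simpa
  refine ⟨⟨sep, fun y hy => sep y fun x => by rw [skew, hy, neg_zero]⟩, skew, fun x y z => ?_⟩
  simp [symplecticForm_apply, coords_mul]
  ring

instance : Nontrivial (J14 F) := ⟨basis F 0, 0, (basis F).ne_zero 0⟩

/-- Stated for arbitrary antidiagonal coefficients so that it covers the symplectic and the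
pseudo-euclidean form at once. -/
theorem isIndecomposable_of_antidiagonal {B : LinearMap.BilinForm F (J14 F)} {a c d e : F}
    (hc : c ≠ 0) (he : e ≠ 0)
    (hB : ∀ x y, B x y = a * coords F x 0 * coords F y 3 + c * coords F x 1 * coords F y 2 +
      d * coords F x 2 * coords F y 1 + e * coords F x 3 * coords F y 0) :
    IsIndecomposable B := by
  refine ⟨inferInstance, fun I hI hnd => ?_⟩
  have sep : ∀ x ∈ I, (∀ y ∈ I, B x y = 0) → x = 0 := fun x hx h =>
    congrArg Subtype.val (hnd.1 ⟨x, hx⟩ fun y => h y.1 y.2)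
  by_cases h : ∀ x ∈ I, coords F x 0 = 0
  · left
    have h2 : ∀ x ∈ I, coords F x 2 = 0 := by
      intro x hx
      -- Here `e₁ * x` is a multiple of `e₄`, which pairs only with first coordinates, and these
      -- vanish on the ideal.
      have h3 : basis F 0 * x = 0 := sep _ (hI _ _ hx).1 fun y hy => by
        simp [hB, coords_mul, coords_basis, h x hx, h y hy]
      simpa [coords_mul, coords_basis] using congrArg (fun x => coords F x 3) h3
    rw [Submodule.eq_bot_iff]
    intro x hx
    exact sep x hx fun y hy => by simp [hB, h x hx, h y hy, h2 x hx, h2 y hy]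
  · right
    push Not at h
    obtain ⟨x, hx, hx0⟩ := h
    have h3 : basis F 3 ∈ I := by
      have : basis F 3 = (coords F x 0)⁻¹ • (basis F 2 * x) := by
        apply ext <;> simp [coords_mul, coords_basis, hx0]
      rw [this]
      exact I.smul_mem _ (hI _ _ hx).1
    have h1 : basis F 1 ∈ I := by
      have : basis F 1 = (coords F x 0)⁻¹ • (basis F 0 * x - coords F x 2 • basis F 3) := by
        apply ext <;> simp [coords_mul, coords_basis, hx0, -Matrix.cons_sub]
      rw [this]
      exact I.smul_mem _ (I.sub_mem (hI _ _ hx).1 (I.smul_mem _ h3))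
    -- The ideal contains the isotropic plane spanned by `e₂, e₄`, so nondegeneracy requires a
    -- second direction modulo that plane. The test vector is the combination of `e₂, e₄` whose
    -- pairing with `y` is this determinant.
    obtain ⟨y, hy, hxy⟩ : ∃ y ∈ I,
        coords F x 2 * coords F y 0 - coords F x 0 * coords F y 2 ≠ 0 := by
      by_contra! hcon
      have := sep ((coords F x 2 / e) • basis F 3 - (coords F x 0 / c) • basis F 1)
        (I.sub_mem (I.smul_mem _ h3) (I.smul_mem _ h1)) fun y hy => by
          have := hcon y hy
          simp [hB, coords_basis]
          field_simp
          linear_combination this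
      have := congrArg (fun x => coords F x 1) this
      simp [coords_basis, hx0, hc] at this
    set D := coords F x 2 * coords F y 0 - coords F x 0 * coords F y 2 with hD
    rw [eq_top_iff]
    intro z _
    -- Cramer's rule for the coordinates of `z` along `e₁, e₃` in terms of `x` and `y`.
    set s := (coords F z 2 * coords F y 0 - coords F z 0 * coords F y 2) / D with hs
    set t := (coords F x 2 * coords F z 0 - coords F x 0 * coords F z 2) / D with ht
    have : z = s • x + t • y +
        (coords F z 1 - s * coords F x 1 - t * coords F y 1) • basis F 1 +
        (coords F z 3 - s * coords F x 3 - t * coords F y 3) • basis F 3 := by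
      apply ext
      · simp [coords_basis, hs, ht]; field_simp; rw [hD]; ring
      · simp [coords_basis]
      · simp [coords_basis, hs, ht]; field_simp; rw [hD]; ring
      · simp [coords_basis]
    rw [this]
    exact I.add_mem (I.add_mem (I.add_mem (I.smul_mem _ hx) (I.smul_mem _ hy))
      (I.smul_mem _ h1)) (I.smul_mem _ h3)

theorem pseudoEuclideanForm_isIndecomposable : IsIndecomposable (pseudoEuclideanForm F) :=
  isIndecomposable_of_antidiagonal (a := 1) (c := 1) (d := 1) (e := 1) one_ne_zero
    one_ne_zero fun x y => by rw [pseudoEuclideanForm_apply]; ring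

theorem symplecticForm_isIndecomposable (htwo : (2 : F) ≠ 0) :
    IsIndecomposable (symplecticForm F) :=
  isIndecomposable_of_antidiagonal (a := 1) (c := 2) (d := -2) (e := -1) htwo
    (neg_ne_zero.2 one_ne_zero) fun x y => by rw [symplecticForm_apply]; ring

theorem finrank_eq : finrank F (J14 F) = 4 := by
  rw [finrank_eq_card_basis (basis F), Fintype.card_fin]

/-- An algebra with a form and a basis in which products and form are those of `J14`. -/
theorem isometricallyIsomorphic_of_basis {J : Type v} [NonUnitalNonAssocRing J] [Module F J]
    [IsScalarTower F J J] [SMulCommClass F J J] {B : LinearMap.BilinForm F J}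
    {B' : LinearMap.BilinForm F (J14 F)} (b : Basis (Fin 4) F J)
    (hmul : ∀ i j, b i * b j = if i = 0 ∧ j = 0 then b 1
      else if (i = 0 ∧ j = 2) ∨ (i = 2 ∧ j = 0) then b 3 else 0)
    (hform : ∀ i j, B (b i) (b j) = B' (basis F i) (basis F j)) :
    IsometricallyIsomorphic B B' := by
  let f := b.equiv (basis F) (Equiv.refl _)
  have hf : ∀ i, f (b i) = basis F i := fun i => by simp [f]
  refine ⟨f, fun x y => ?_, fun x y => ?_⟩
  · have : (LinearMap.mul F J).compr₂ f.toLinearMap =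
        (LinearMap.mul F (J14 F)).compl₁₂ f.toLinearMap f.toLinearMap := by
      refine b.ext fun i => b.ext fun j => ?_
      simp only [LinearMap.compr₂_apply, LinearMap.compl₁₂_apply, LinearMap.mul_apply',
        LinearEquiv.coe_coe, hf, basis_mul_basis, hmul]
      split_ifs <;> simp [hf]
    exact LinearMap.congr_fun₂ this x y
  · have : B'.compl₁₂ f.toLinearMap f.toLinearMap = B := by
      refine b.ext fun i => b.ext fun j => ?_
      simp only [LinearMap.compl₁₂_apply, LinearEquiv.coe_coe, hf, hform]
    exact LinearMap.congr_fun₂ this x y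

/-- The isometry with `J14` determined by two elements which play the roles of `e₁` and `e₃`. -/
theorem isometricallyIsomorphic_of_generators {J : Type v} [NonUnitalNonAssocRing J] [Module F J]
    [IsScalarTower F J J] [SMulCommClass F J J] {B : LinearMap.BilinForm F J}
    {B' : LinearMap.BilinForm F (J14 F)} (hB : B.Nondegenerate) (hB' : B'.Nondegenerate)
    (hn : finrank F J = 4) (hcomm : ∀ x y : J, x * y = y * x) (hcl : ∀ x y z : J, x * y * z = 0)
    (x y : J) (hyyx : B (y * y) x = 0) (hyyy : B (y * y) y = 0)
    (hiso : ∀ x y z t : J, B (x * y) (z * t) = 0)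
    (hform : ∀ i j, B (![x, x * x, y, x * y] i) (![x, x * x, y, x * y] j) =
      B' (basis F i) (basis F j)) :
    IsometricallyIsomorphic B B' := by
  have hli : LinearIndependent F ![x, x * x, y, x * y] :=
    linearIndependent_of_gram_eq hB' (basis F) _ hform
  let b := basisOfLinearIndependentOfCardEqFinrank hli (by simp [hn])
  have hb : ⇑b = ![x, x * x, y, x * y] := coe_basisOfLinearIndependentOfCardEqFinrank _ _
  -- The only product not prescribed by the choice of basis; it vanishes because it is orthogonal to
  -- all basis vectors.
  have hyy : y * y = 0 := eq_zero_of_forall_basis hB b fun i => by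
    rw [hb]
    fin_cases i <;> simp [hyyx, hyyy, hiso]
  refine isometricallyIsomorphic_of_basis b (fun i j => ?_) (by simpa only [hb] using hform)
  have hcl' : ∀ x y z : J, x * (y * z) = 0 := fun x y z => by rw [hcomm, hcl]
  rw [hb]
  fin_cases i <;> fin_cases j <;> simp [hcl, hcl', hyy, hcomm y x]

end J14

/-! ### Nilpotency of class two -/

section ClassTwo

variable {F : Type u} {J : Type v} [Field F] [NonUnitalNonAssocRing J] [Module F J]

namespace IsJacobiJordan

/-- If all squares annihilate the algebra, then so do all products. -/
theorem mul_mul_eq_zero_of_sq (h : IsJacobiJordan J) (h2 : (2 : F) ≠ 0)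
    (hsq : ∀ x y : J, x * x * y = 0) (x y z : J) : x * y * z = 0 := by
  have h1 := hsq (x + y) z
  simp only [mul_add, add_mul, hsq, h.mul_comm y x] at h1
  have : (2 : F) • (x * y * z) = 0 := by linear_combination (norm := module) h1
  exact (smul_eq_zero.1 this).resolve_left h2

/-- Some square is nonzero if some product is. -/
theorem exists_sq_ne_zero (h : IsJacobiJordan J) (h2 : (2 : F) ≠ 0)
    (hnt : HasNontrivialProduct J) : ∃ x : J, x * x ≠ 0 := by
  by_contra! hcon
  obtain ⟨a, b, hab⟩ := hnt
  have h1 := hcon (a + b)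
  rw [mul_add, add_mul, add_mul, hcon, hcon, h.mul_comm b a] at h1
  have : (2 : F) • (a * b) = 0 := by linear_combination (norm := module) h1
  exact hab ((smul_eq_zero.1 this).resolve_left h2)

variable [IsScalarTower F J J] [SMulCommClass F J J] [Module.Finite F J]

/-- Suppose `z = x * (x * y)` is nonzero. If `x * x` is a multiple of `z`, then `y` multiplies `z`
by a nonzero scalar, which is impossible. Otherwise `y, x * y, z, x * x` is a basis; expanding `x`
in it and multiplying by `x` writes `x * x` through `x * y` and `z`, a contradiction. -/
theorem mul_mul_eq_zero_of_finrank_le_four (h : IsJacobiJordan J) (h2 : (2 : F) ≠ 0)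
    (h3 : (3 : F) ≠ 0) (hn : finrank F J ≤ 4) (x y : J) : x * (x * y) = 0 := by
  by_contra hz
  set z := x * (x * y) with hzdef
  have hxz : x * z = 0 := h.mul_mul_mul F h2 h3 x y
  have hxu : x * (x * x) = 0 := h.mul_mul_self F h3 x
  by_cases hu : ∃ c : F, x * x = c • z
  · obtain ⟨c, hc⟩ := hu
    have h1 := h.sq_mul F x y
    rw [hc, smul_mul_assoc, ← hzdef] at h1
    have hc0 : c ≠ 0 := by
      rintro rfl
      rw [zero_smul, eq_comm, smul_eq_zero] at h1
      exact h1.elim (neg_ne_zero.2 h2) hz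
    have h4 : y * z = (c⁻¹ * -2) • z := by
      rw [h.mul_comm, mul_smul, ← h1, smul_smul, inv_mul_cancel₀ hc0, one_smul]
    have := h.eigenvalue_eq_zero h2 h3 hz h4
    simp [hc0, h2] at this
  · push Not at hu
    have hli : LinearIndependent F ![y, x * y, z, x * x] := by
      rw [Fintype.linearIndependent_iff]
      intro g hg
      simp only [Fin.sum_univ_four, Matrix.cons_val] at hg
      have e1 := congrArg (x * ·) hg
      simp only [mul_add, mul_smul_comm, hxz, hxu, ← hzdef, smul_zero, add_zero, mul_zero] at e1
      have e2 := congrArg (x * ·) e1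
      simp only [mul_add, mul_smul_comm, hxz, ← hzdef, smul_zero, add_zero, mul_zero] at e2
      have g0 : g 0 = 0 := (smul_eq_zero.1 e2).resolve_right hz
      rw [g0, zero_smul, zero_add] at e1
      have g1 : g 1 = 0 := (smul_eq_zero.1 e1).resolve_right hz
      have g3 : g 3 = 0 := by
        by_contra g3
        refine hu (-(g 3)⁻¹ * g 2) ?_
        rw [g0, g1] at hg
        have : g 3 • (x * x) = -(g 2 • z) := by linear_combination (norm := module) hg
        rw [← inv_smul_smul₀ g3 (x * x), this]
        module
      rw [g0, g1, g3] at hg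
      have g2 : g 2 = 0 := by simpa [hz] using hg
      intro i
      fin_cases i <;> assumption
    have hcard : Fintype.card (Fin 4) = finrank F J :=
      le_antisymm hli.fintype_card_le_finrank (by simpa using hn)
    have hspan := hli.span_eq_top_of_card_eq_finrank' hcard
    have hx : x ∈ Submodule.span F (Set.range ![y, x * y, z, x * x]) := by rw [hspan]; trivial
    rw [Submodule.mem_span_range_iff_exists_fun] at hx
    obtain ⟨g, hg⟩ := hx
    simp only [Fin.sum_univ_four, Matrix.cons_val] at hg
    have e1 := congrArg (x * ·) hg
    simp only [mul_add, mul_smul_comm, hxz, hxu, ← hzdef, smul_zero, add_zero] at e1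
    have e2 := Fintype.linearIndependent_iff.1 hli ![0, g 0, g 1, -1] (by
      simp only [Fin.sum_univ_four, Matrix.cons_val]
      linear_combination (norm := module) e1) 3
    simp at e2

end IsJacobiJordan

end ClassTwo

/-! ### The symplectic case -/

section Symplectic

variable {F : Type u} {J : Type v} [Field F] [NonUnitalNonAssocRing J] [Module F J]
  [IsScalarTower F J J] [SMulCommClass F J J] {ω : LinearMap.BilinForm F J}

/-- Symplectic Jacobi-Jordan algebras of dimension four with suitable generators. -/
theorem IsSymplecticForm.isometricallyIsomorphic_of_generators (hω : IsSymplecticForm ω)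
    (h : IsJacobiJordan J) (h2 : (2 : F) ≠ 0) (hn : finrank F J = 4)
    (hcl : ∀ x y z : J, x * y * z = 0) (hiso : ∀ x y z t : J, ω (x * y) (z * t) = 0)
    (x y : J) (hyyx : ω (y * y) x = 0) (hyyy : ω (y * y) y = 0) (hxxx : ω (x * x) x = 0)
    (hxxy : ω (x * x) y = 2) (hxyx : ω (x * y) x = -1) (hxyy : ω (x * y) y = 0) :
    IsometricallyIsomorphic ω (J14.symplecticForm F) := by
  have hself : ∀ v, ω v v = 0 := fun v => by
    have h1 := hω.skew v v
    have : 2 * ω v v = 0 := by linear_combination h1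
    simpa [h2] using this
  have hcl' : ∀ x y z : J, x * (y * z) = 0 := fun x y z => by rw [h.mul_comm, hcl]
  -- Since `ω (x * x) y = 2`, this multiple of `x * x` makes `e` orthogonal to `y`; being a product,
  -- it leaves `e * e` and `e * y` unchanged.
  obtain ⟨e, he⟩ : ∃ e, e = x + (-ω x y / 2) • (x * x) := ⟨_, rfl⟩
  have hee : e * e = x * x := by simp [he, mul_add, add_mul, hcl, hcl', smul_mul_assoc, mul_smul_comm]
  have hey : e * y = x * y := by simp [he, add_mul, hcl, smul_mul_assoc]
  have hwey : ω e y = 0 := by simp [he, hxxy, h2]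
  have h1 : ω (x * x) e = 0 := by simp [he, hxxx, hiso]
  have h3 : ω (x * y) e = -1 := by simp [he, hxyx, hiso]
  have h4 : ω (y * y) e = 0 := by simp [he, hyyx, hiso]
  refine J14.isometricallyIsomorphic_of_generators hω.nondegenerate
    (J14.isSymplecticForm h2).nondegenerate hn h.mul_comm hcl e y h4 hyyy hiso fun i j => ?_
  rw [hee, hey]
  fin_cases i <;> fin_cases j <;>
    simp [J14.symplecticForm_apply, J14.coords_basis, hself, hwey, h1, h3, hiso, hxxy, hxyy,
      hω.skew e (x * x), hω.skew e (x * y), hω.skew y e, hω.skew y (x * x), hω.skew y (x * y)]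

/-- Nontrivial symplectic Jacobi-Jordan algebras of dimension at most five. -/
theorem IsSymplecticForm.isometricallyIsomorphic_J14 [Module.Finite F J]
    (hω : IsSymplecticForm ω) (h : IsJacobiJordan J) (h2 : (2 : F) ≠ 0) (h3 : (3 : F) ≠ 0)
    (hnt : HasNontrivialProduct J) (hn : finrank F J ≤ 5) :
    IsometricallyIsomorphic ω (J14.symplecticForm F) := by
  have hn4 : finrank F J ≤ 4 := by
    have := even_finrank_of_skew h2 hω.nondegenerate hω.skew
    by_contra hcon
    have h5 : finrank F J = 5 := by omega
    rw [h5] at this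
    exact absurd this (by decide)
  have hcl : ∀ x y z : J, x * y * z = 0 := h.mul_mul_eq_zero_of_sq h2 fun x y => by
    rw [h.sq_mul F, h.mul_mul_eq_zero_of_finrank_le_four h2 h3 hn4, smul_zero]
  have hcl' : ∀ x y z : J, x * (y * z) = 0 := fun x y z => by rw [h.mul_comm, hcl]
  have hiso : ∀ x y z t : J, ω (x * y) (z * t) = 0 := fun x y z t => by
    simpa [hcl, hcl'] using hω.closed x y (z * t)
  have hxxx : ∀ x : J, ω (x * x) x = 0 := fun x => by
    have : 3 * ω (x * x) x = 0 := by linear_combination hω.closed x x x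
    simpa [h3] using this
  have hxyx : ∀ x y : J, ω (x * y) x = -ω (x * x) y / 2 := fun x y => by
    have := hω.closed x x y
    rw [h.mul_comm y x] at this
    field_simp
    linear_combination this
  have hxyy : ∀ x y : J, ω (x * y) y = -ω (y * y) x / 2 := fun x y => by
    rw [h.mul_comm, hxyx]
  obtain ⟨x, hx⟩ := h.exists_sq_ne_zero h2 hnt
  obtain ⟨y, hp⟩ : ∃ y, ω (x * x) y ≠ 0 := by
    by_contra! hcon
    exact hx (hω.nondegenerate.1 _ hcon)
  obtain ⟨p, hpdef⟩ : ∃ p, ω (x * x) y = p := ⟨_, rfl⟩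
  obtain ⟨q, hqdef⟩ : ∃ q, ω (y * y) x = q := ⟨_, rfl⟩
  rw [hpdef] at hp
  have hn' : finrank F J = 4 := by
    have : LinearIndependent F ![y, x, x * y, x * x] := by
      have hskx : ω x (x * x) = 0 := by rw [hω.skew, hxxx, neg_zero]
      refine linearIndependent_of_gram_triangular ω ![x * x, x * y, x, y] _ ?_ ?_
      · intro i j hij
        fin_cases i <;> fin_cases j <;>
          simp [hiso, hxxx, hskx] at hij ⊢
      · intro i
        fin_cases i <;> simp [hω.skew x (x * y), hω.skew y (x * x), hpdef, hxyx, hp, h2]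
    have := this.fintype_card_le_finrank
    rw [Fintype.card_fin] at this
    omega
  -- The direction `q x + p y` gives `ω (z * z) x = 0`, and the factor `2 / p ^ 2` gives `ω (x * x)
  -- z = 2`.
  obtain ⟨z, hz⟩ : ∃ z, z = (2 / p ^ 2) • (q • x + p • y) := ⟨_, rfl⟩
  have hxxz : ω (x * x) z = 2 := by
    simp [hz, hxxx, hpdef]
    field_simp
  have hzzx : ω (z * z) x = 0 := by
    simp only [hz, mul_add, add_mul, smul_mul_assoc, mul_smul_comm, map_add, map_smul,
      LinearMap.add_apply, LinearMap.smul_apply, smul_eq_mul, hxxx, hqdef, h.mul_comm y x, hxyx,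
      hpdef]
    field_simp
    ring
  refine hω.isometricallyIsomorphic_of_generators h h2 hn' hcl hiso x z hzzx (hxxx z) (hxxx x)
    hxxz ?_ ?_
  · rw [hxyx, hxxz]; field_simp
  · rw [hxyy, hzzx]; simp

end Symplectic

/-! ### The pseudo-euclidean case -/

/-- The square of a nilpotent operator of index at most three has rank at most one in dimension at
most five. -/
theorem exists_smul_eq_of_cube_eq_zero {F : Type u} {V : Type v} [Field F] [AddCommGroup V]
    [Module F V] [Module.Finite F V] (hn : finrank F V ≤ 5) (N : V →ₗ[F] V)
    (hN : ∀ v, N (N (N v)) = 0) {y : V} (hy : N (N y) ≠ 0) (t : V) :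
    ∃ c : F, c • N (N y) = N (N t) := by
  by_contra! hcon
  -- If the images of `y` and `t` under `N²` were independent, two full Jordan chains of length
  -- three would give six independent vectors.
  have hpair := LinearIndependent.pair_iff.1 ((LinearIndependent.pair_iff' hy).2 hcon)
  have hli : LinearIndependent F ![y, t, N y, N t, N (N y), N (N t)] := by
    rw [Fintype.linearIndependent_iff]
    intro g hg
    simp only [Fin.sum_univ_six, Matrix.cons_val] at hg
    have e1 := congrArg N hg
    simp only [map_add, map_smul, hN, smul_zero, add_zero, map_zero] at e1
    have e2 := congrArg N e1
    simp only [map_add, map_smul, hN, smul_zero, add_zero, map_zero] at e2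
    obtain ⟨g0, g1⟩ := hpair _ _ e2
    simp only [g0, g1, zero_smul, zero_add] at e1 hg
    obtain ⟨g2, g3⟩ := hpair _ _ e1
    simp only [g2, g3, zero_smul, zero_add] at hg
    obtain ⟨g4, g5⟩ := hpair _ _ hg
    intro i
    fin_cases i <;> assumption
  have := hli.fintype_card_le_finrank
  rw [Fintype.card_fin] at this
  omega

section PseudoEuclidean

variable {F : Type u} {J : Type v} [Field F] [NonUnitalNonAssocRing J] [Module F J]
  {B : LinearMap.BilinForm F J}

/-- A symmetric bilinear form which is not zero takes a nonzero value on the diagonal. -/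
theorem exists_diag_ne_zero {V : Type w} [AddCommGroup V] [Module F V] (h2 : (2 : F) ≠ 0)
    (S : LinearMap.BilinForm F V) (hS : ∀ x y, S x y = S y x) {x y : V} (h : S x y ≠ 0) :
    ∃ z, S z z ≠ 0 := by
  by_contra! hcon
  have h1 := hcon (x + y)
  simp only [map_add, LinearMap.add_apply, hcon, hS y x] at h1
  have : 2 * S x y = 0 := by linear_combination h1
  exact h ((mul_eq_zero.1 this).resolve_left h2)

namespace IsPseudoEuclideanForm

/-- Together with `swap` this makes `B (x * y) z` symmetric in its three arguments. -/
theorem rotate (hB : IsPseudoEuclideanForm B) (x y z : J) : B (x * y) z = B (y * z) x := by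
  rw [hB.invariant, hB.symm]

theorem swap (hB : IsPseudoEuclideanForm B) (h : IsJacobiJordan J) (x y z : J) :
    B (x * y) z = B (x * z) y := by
  rw [h.mul_comm, hB.invariant, hB.symm]

theorem mul_left_adjoint (hB : IsPseudoEuclideanForm B) (h : IsJacobiJordan J) (x y z : J) :
    B (x * y) z = B y (x * z) := by
  rw [h.mul_comm, hB.invariant]

/-- A nontrivial algebra has an element on which the associated cubic form does not vanish. -/
theorem exists_cubic_ne_zero (hB : IsPseudoEuclideanForm B) (h : IsJacobiJordan J)
    (h2 : (2 : F) ≠ 0) (h3 : (3 : F) ≠ 0) (hnt : HasNontrivialProduct J) :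
    ∃ e : J, B (e * e) e ≠ 0 := by
  by_contra! hcon
  obtain ⟨x, hx⟩ := h.exists_sq_ne_zero h2 hnt
  apply hx
  apply hB.nondegenerate.1
  intro y
  have e1 := hcon (y + x)
  have e2 := hcon (y - x)
  simp only [add_mul, mul_add, sub_mul, mul_sub, map_add, map_sub, LinearMap.add_apply,
    LinearMap.sub_apply, hcon, h.mul_comm y x, hB.swap h x y x, hB.rotate y y x] at e1 e2
  -- Adding the cubic form at `y + x` and at `y - x` leaves only the terms that are even in `x`.
  have : (2 * 3) * B (x * x) y = 0 := by linear_combination e1 + e2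
  exact (mul_eq_zero.1 this).resolve_left (mul_ne_zero h2 h3)

variable [IsScalarTower F J J] [SMulCommClass F J J]

/-! ### Nilpotency of class two for pseudo-euclidean algebras -/

/-- If `x (x y)` does not vanish identically in `y`, then it is not skew. -/
theorem exists_sq_apply_ne_zero (hB : IsPseudoEuclideanForm B) (h : IsJacobiJordan J)
    (h2 : (2 : F) ≠ 0) {x y : J} (hxy : x * (x * y) ≠ 0) : ∃ y, B (x * (x * y)) y ≠ 0 := by
  let S : LinearMap.BilinForm F J := B ∘ₗ (LinearMap.mul F J x ∘ₗ LinearMap.mul F J x)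
  have hS : ∀ s t, S s t = B (x * (x * s)) t := fun s t => rfl
  obtain ⟨t, ht⟩ : ∃ t, S y t ≠ 0 := by
    by_contra! hcon
    exact hxy (hB.nondegenerate.1 _ hcon)
  exact exists_diag_ne_zero h2 S (fun s t => by
    rw [hS, hS, hB.mul_left_adjoint h, hB.mul_left_adjoint h, hB.symm]) ht

/-- In dimension at most five all products `x (x y)` annihilate the algebra. -/
theorem sq_apply_mul_eq_zero [Module.Finite F J] (hB : IsPseudoEuclideanForm B)
    (h : IsJacobiJordan J) (h2 : (2 : F) ≠ 0) (h3 : (3 : F) ≠ 0) (hn : finrank F J ≤ 5)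
    (x y w : J) : x * (x * y) * w = 0 := by
  by_cases hxy : x * (x * y) = 0
  · rw [hxy, zero_mul]
  obtain ⟨v, hv⟩ := hB.exists_sq_apply_ne_zero h h2 hxy
  obtain ⟨z, hz⟩ : ∃ z, z = x * (x * v) := ⟨_, rfl⟩
  rw [← hz] at hv
  have hz0 : z ≠ 0 := by rintro rfl; simp at hv
  have hrank : ∀ t, ∃ c : F, c • z = x * (x * t) := fun t => by
    have := exists_smul_eq_of_cube_eq_zero hn (LinearMap.mul F J x)
      (fun t => h.mul_mul_mul F h2 h3 x t) (y := v) (by simpa [← hz] using hz0) t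
    simpa [← hz] using this
  -- `L_x²` has rank one with image spanned by `z`, and self-adjointness gives `d ≠ 0`. The Jacobi
  -- identity for `x * x, s, s` then shows that `z` is an eigenvector of `L_s`, necessarily with
  -- eigenvalue zero.
  have key : ∀ s, B z s ≠ 0 → s * z = 0 := fun s hs => by
    obtain ⟨c, hc⟩ := hrank (s * s)
    obtain ⟨d, hd⟩ := hrank s
    have hd0 : d ≠ 0 := by
      rintro rfl
      rw [zero_smul] at hd
      apply hs
      rw [hz, hB.mul_left_adjoint h, hB.mul_left_adjoint h, ← hd, map_zero]
    have hj := h.jacobi (x * x) s s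
    rw [h.mul_comm s (x * x), h.sq_mul F, h.sq_mul F, ← hc, ← hd, mul_smul_comm,
      mul_smul_comm] at hj
    have h4 : (4 * d) • (s * z) = (-2 * c) • z := by linear_combination (norm := module) -hj
    have h4d : 4 * d ≠ 0 := by
      have : (4 : F) = 2 * 2 := by norm_num
      rw [this]; exact mul_ne_zero (mul_ne_zero h2 h2) hd0
    have h5 : s * z = ((4 * d)⁻¹ * (-2 * c)) • z := by
      rw [mul_smul, ← h4, inv_smul_smul₀ h4d]
    rw [h5, h.eigenvalue_eq_zero h2 h3 hz0 h5, zero_smul]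
  -- Vectors off the hyperplane orthogonal to `z` span the space.
  have hann : ∀ s, s * z = 0 := fun s => by
    by_cases hs : B z s = 0
    · have h1 := key (s + v) (by rwa [map_add, hs, zero_add])
      rwa [add_mul, key v hv, add_zero] at h1
    · exact key s hs
  obtain ⟨c, hc⟩ := hrank y
  rw [← hc, smul_mul_assoc, h.mul_comm, hann, smul_zero]

/-- In dimension at most five all threefold products vanish. -/
theorem mul_mul_eq_zero [Module.Finite F J] (hB : IsPseudoEuclideanForm B)
    (h : IsJacobiJordan J) (h2 : (2 : F) ≠ 0) (h3 : (3 : F) ≠ 0) (hn : finrank F J ≤ 5)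
    (x y w : J) : x * y * w = 0 := by
  refine h.mul_mul_eq_zero_of_sq h2 (fun x y₀ => ?_) x y w
  by_contra hne
  rw [h.sq_mul F] at hne
  obtain ⟨y, hy⟩ := hB.exists_sq_apply_ne_zero h h2 (right_ne_zero_of_smul hne)
  have hann := hB.sq_apply_mul_eq_zero h h2 h3 hn
  obtain ⟨z, hz⟩ : ∃ z, z = x * (x * y) := ⟨_, rfl⟩
  have hzann : ∀ w, z * w = 0 := fun w => by rw [hz, hann]
  rw [← hz] at hy
  have hzmul : ∀ s t, B z (s * t) = 0 := fun s t => by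
    rw [← hB.invariant, hzann, map_zero, LinearMap.zero_apply]
  have hmulz : ∀ s t, B (s * t) z = 0 := fun s t => by rw [hB.symm, hzmul]
  have hcube := h.mul_mul_self F h3
  have hzz : B z z = 0 := by nth_rw 2 [hz]; rw [hzmul]
  have e1 : B (y * y) (x * x) = -2 * B z y := by
    rw [hB.symm, ← hB.invariant, h.sq_mul F, ← hz, map_smul, LinearMap.smul_apply, smul_eq_mul]
  have e2 : B (y * y) (x * y) = 0 := by
    rw [h.mul_comm x y, ← hB.invariant, h.mul_comm (y * y) y, hcube, map_zero,
      LinearMap.zero_apply]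
  have e3 : B (y * y) (y * y) = 0 := by
    rw [← hB.invariant, h.mul_comm (y * y) y, hcube, map_zero, LinearMap.zero_apply]
  have e4 : B (x * y) (x * y) = B z y := by rw [hz, hB.mul_left_adjoint h x (x * y)]
  -- The diagonal Gram entries are `B z y` up to the factor `-2`, so these five vectors form a
  -- basis. Pairing with `z` removes `y` from the expansion of `x`; the remaining terms contribute
  -- nothing to `B (x * y) (x * y) = B z y`, a contradiction.
  have hli : LinearIndependent F ![y, x * x, x * y, y * y, z] := by
    refine linearIndependent_of_gram_triangular B ![z, y * y, x * y, x * x, y] _ ?_ ?_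
    · intro i j hij
      fin_cases i <;> fin_cases j <;>
        simp [hzmul, hmulz, hzz, e2, e3, hB.symm (x * y) (y * y)] at hij ⊢
    · intro i
      fin_cases i <;> simp [hy, e1, e4, h2, hB.symm (x * x) (y * y), hB.symm y z]
  have hcard : Fintype.card (Fin 5) = finrank F J :=
    le_antisymm hli.fintype_card_le_finrank (by simpa using hn)
  have hx : x ∈ Submodule.span F (Set.range ![y, x * x, x * y, y * y, z]) := by
    rw [hli.span_eq_top_of_card_eq_finrank' hcard]; trivial
  rw [Submodule.mem_span_range_iff_exists_fun] at hx
  obtain ⟨g, hg⟩ := hx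
  simp only [Fin.sum_univ_five, Matrix.cons_val] at hg
  have hzx : B z x = 0 := by
    rw [hz, hB.mul_left_adjoint h, h.mul_comm x y, hB.invariant, hcube, map_zero]
  have g0 : g 0 = 0 := by
    have := congrArg (B z) hg
    simpa [hzmul, hzz, hzx, hy] using this
  have h5 := congrArg (fun s => B (s * y) (x * y)) hg
  have e5 : B (x * y * y) (x * y) = 0 := by
    rw [h.mul_comm (x * y) y, h.mul_comm x y, ← hB.invariant, hann, map_zero,
      LinearMap.zero_apply]
  have e6 : B (x * x * y) (x * y) = 0 := by
    rw [h.sq_mul F, ← hz, map_smul, LinearMap.smul_apply, hzmul, smul_zero]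
  have e7 : y * y * y = 0 := by rw [h.mul_comm, hcube]
  simp only [g0, zero_smul, zero_add, add_mul, smul_mul_assoc, map_add, map_smul,
    LinearMap.add_apply, LinearMap.smul_apply, e5, e6, e7, hzann,
    smul_zero, add_zero, e4] at h5
  exact hy h5.symm

/-! ### The annihilator as a Lagrangian subspace -/

/-- The form of an indecomposable nontrivial algebra vanishes on the annihilator. -/
theorem apply_eq_zero_of_annihilates (hB : IsPseudoEuclideanForm B) (h : IsJacobiJordan J)
    (h2 : (2 : F) ≠ 0) (hnt : HasNontrivialProduct J) (hind : IsIndecomposable B) {a b : J}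
    (ha : ∀ w, a * w = 0) (hb : ∀ w, b * w = 0) : B a b = 0 := by
  have hdiag : ∀ a : J, (∀ w, a * w = 0) → B a a = 0 := fun a ha => by
    by_contra haa
    have ha' : ∀ w, w * a = 0 := fun w => by rw [h.mul_comm, ha]
    have sep : ∀ x ∈ Submodule.span F {a}, B x a = 0 → x = 0 := fun x hx hxa => by
      obtain ⟨c, rfl⟩ := Submodule.mem_span_singleton.1 hx
      have : c = 0 := by simpa [haa] using hxa
      rw [this, zero_smul]
    have hmem := Submodule.mem_span_singleton_self (R := F) a
    have hideal : IsAlgebraIdeal (Submodule.span F {a}) := fun x y hy => by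
      obtain ⟨c, rfl⟩ := Submodule.mem_span_singleton.1 hy
      simp [ha, ha', smul_mul_assoc, mul_smul_comm]
    -- A non-isotropic annihilating vector spans a nondegenerate ideal; it cannot be everything,
    -- because its product is zero.
    rcases hind.2 _ hideal
      ⟨fun x hx => Subtype.ext (sep x x.2 (hx ⟨a, hmem⟩)),
        fun x hx => Subtype.ext (sep x x.2 (by rw [hB.symm]; exact hx ⟨a, hmem⟩))⟩ with h1 | h1
    · rw [Submodule.span_singleton_eq_bot] at h1
      rw [h1, map_zero] at haa
      exact haa rfl
    · obtain ⟨x, y, hxy⟩ := hnt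
      have hx : x ∈ Submodule.span F {a} := by rw [h1]; trivial
      obtain ⟨c, rfl⟩ := Submodule.mem_span_singleton.1 hx
      rw [smul_mul_assoc, ha, smul_zero] at hxy
      exact hxy rfl
  have h1 := hdiag (a + b) fun w => by rw [add_mul, ha, hb, add_zero]
  simp only [map_add, LinearMap.add_apply, hdiag a ha, hdiag b hb, hB.symm b a] at h1
  have : 2 * B a b = 0 := by linear_combination h1
  exact (mul_eq_zero.1 this).resolve_left h2

/-- In class two, the annihilator of an indecomposable nontrivial algebra has half the
dimension. -/
theorem finrank_eq_two_mul [Module.Finite F J] (hB : IsPseudoEuclideanForm B)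
    (h : IsJacobiJordan J) (h2 : (2 : F) ≠ 0) (hnt : HasNontrivialProduct J)
    (hind : IsIndecomposable B) (hcl : ∀ x y z : J, x * y * z = 0) :
    finrank F J = 2 * finrank F (LinearMap.ker (LinearMap.mul F J)) := by
  have hmem : ∀ a, a ∈ LinearMap.ker (LinearMap.mul F J) ↔ ∀ w, a * w = 0 := fun a => by
    rw [LinearMap.mem_ker, LinearMap.ext_iff]; rfl
  have hrefl : B.IsRefl := fun x y hxy => by rw [hB.symm, hxy]
  set A := LinearMap.ker (LinearMap.mul F J)
  let S : Submodule F J := Submodule.span F {s | ∃ x y : J, x * y = s}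
  have hSA : S ≤ A := Submodule.span_le.2 fun s ⟨x, y, hs⟩ => by
    subst hs
    exact (hmem _).2 (hcl x y)
  have hSo : B.orthogonal S ≤ A := fun a ha => (hmem a).2 fun w => by
    apply hB.nondegenerate.1
    intro t
    rw [hB.invariant, hB.symm]
    exact LinearMap.BilinForm.mem_orthogonal_iff.1 ha _ (Submodule.subset_span ⟨w, t, rfl⟩)
  -- Invariance puts the orthogonal of the products inside `A`; taking orthogonals puts that of `A`
  -- inside the span of products, which lies in `A` by class two.
  have hle : B.orthogonal A ≤ A := by
    calc B.orthogonal A ≤ B.orthogonal (B.orthogonal S) :=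
          LinearMap.BilinForm.orthogonal_le hSo
      _ = S := LinearMap.BilinForm.orthogonal_orthogonal hB.nondegenerate hrefl S
      _ ≤ A := hSA
  have hge : A ≤ B.orthogonal A := fun a ha => LinearMap.BilinForm.mem_orthogonal_iff.2
    fun b hb => hB.apply_eq_zero_of_annihilates h h2 hnt hind ((hmem b).1 hb) ((hmem a).1 ha)
  have h1 := LinearMap.BilinForm.finrank_orthogonal hB.nondegenerate A
  rw [le_antisymm hle hge] at h1
  have := Submodule.finrank_le A
  omega

/-! ### Binary cubic forms and their algebras -/

/-- Two elements on whose span the cubic form is `3 s² t` up to a nonzero factor. -/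
theorem isometricallyIsomorphic_J14_of_cubic (hB : IsPseudoEuclideanForm B)
    (h : IsJacobiJordan J) (h2 : (2 : F) ≠ 0) (hn : finrank F J = 4)
    (hcl : ∀ x y z : J, x * y * z = 0) {x y : J} (hxxx : B (x * x) x = 0)
    (hxxy : B (x * x) y ≠ 0) (hxyy : B (x * y) y = 0) (hyyy : B (y * y) y = 0) :
    IsometricallyIsomorphic B (J14.pseudoEuclideanForm F) := by
  have hcl' : ∀ x y z : J, x * (y * z) = 0 := fun x y z => by rw [h.mul_comm, hcl]
  have hiso : ∀ x y z t : J, B (x * y) (z * t) = 0 := fun x y z t => by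
    rw [hB.invariant, hcl', map_zero]
  obtain ⟨a, ha⟩ : ∃ a, a = B (x * x) y := ⟨_, rfl⟩
  rw [← ha] at hxxy
  have hxyx : B (x * y) x = a := by rw [hB.swap h, ha]
  have hyyx : B (y * y) x = 0 := by rw [← hB.rotate, hxyy]
  -- The coefficients of the added products are solved from `B f f = 0`, and in the next line from
  -- `B e f = 0` and `B e e = 0`.
  obtain ⟨f, hf⟩ : ∃ f, f = a⁻¹ • y + (-B y y / (2 * a ^ 2)) • (x * x) := ⟨_, rfl⟩
  obtain ⟨e, he⟩ : ∃ e, e = x + (-a⁻¹ * B x y) • (x * x) + (-B x x / (2 * a)) • (x * y) :=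
    ⟨_, rfl⟩
  have hee : e * e = x * x := by
    simp [he, mul_add, add_mul, hcl, hcl', smul_mul_assoc, mul_smul_comm]
  have hef : e * f = a⁻¹ • (x * y) := by
    simp [he, hf, mul_add, add_mul, hcl, hcl', smul_mul_assoc, mul_smul_comm]
  have hff : f * f = (a⁻¹ * a⁻¹) • (y * y) := by
    simp [hf, mul_add, add_mul, hcl, hcl', smul_mul_assoc, mul_smul_comm, smul_smul]
  have b1 : B (x * x) e = 0 := by simp [he, hxxx, hiso]
  have b2 : B (x * x) f = 1 := by simp [hf, ← ha, hiso, hxxy]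
  have b3 : B (x * y) e = a := by simp [he, hxyx, hiso]
  have b4 : B (x * y) f = 0 := by simp [hf, hxyy, hiso]
  have b5 : B e e = 0 := by
    nth_rw 1 [he]
    simp only [map_add, map_smul, LinearMap.add_apply, LinearMap.smul_apply, b1, b3]
    simp only [he, map_add, map_smul, hB.symm x (x * x), hB.symm x (x * y), hxxx, hxyx,
      smul_eq_mul]
    field_simp
    ring
  have b6 : B f e = 0 := by
    rw [hB.symm, he]
    simp only [map_add, map_smul, LinearMap.add_apply, LinearMap.smul_apply, b2, b4]
    simp only [hf, map_add, map_smul, hB.symm x (x * x), hxxx, smul_eq_mul]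
    field_simp
    ring
  have b7 : B f f = 0 := by
    nth_rw 1 [hf]
    simp only [map_add, map_smul, LinearMap.add_apply, LinearMap.smul_apply, b2]
    simp only [hf, map_add, map_smul, hB.symm y (x * x), ← ha, smul_eq_mul]
    field_simp
    ring
  have b8 : B (y * y) e = 0 := by simp [he, hyyx, hiso]
  have b9 : B (y * y) f = 0 := by simp [hf, hyyy, hiso]
  refine J14.isometricallyIsomorphic_of_generators hB.nondegenerate
    J14.isPseudoEuclideanForm.nondegenerate hn h.mul_comm hcl e f (by simp [hff, b8])
    (by simp [hff, b9]) hiso fun i j => ?_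
  rw [hee, hef]
  fin_cases i <;> fin_cases j <;>
    simp [J14.pseudoEuclideanForm_apply, J14.coords_basis, b1, b2, b3, b4, b5, b6, b7, hiso, hxxy,
      hB.symm e (x * x), hB.symm e (x * y), hB.symm e f, hB.symm f (x * x), hB.symm f (x * y)]

/-- If the cubic form is a sum of two cubes, the algebra decomposes. -/
theorem not_isIndecomposable_of_cubic [Module.Finite F J] (hB : IsPseudoEuclideanForm B)
    (h : IsJacobiJordan J) (hn : finrank F J = 4)
    (hcl : ∀ x y z : J, x * y * z = 0) {e g : J} (heee : B (e * e) e ≠ 0)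
    (heeg : B (e * e) g = 0) (hegg : B (e * g) g = 0) (hggg : B (g * g) g ≠ 0) :
    ¬ IsIndecomposable B := by
  intro hind
  have hcl' : ∀ x y z : J, x * (y * z) = 0 := fun x y z => by rw [h.mul_comm, hcl]
  have hiso : ∀ x y z t : J, B (x * y) (z * t) = 0 := fun x y z t => by
    rw [hB.invariant, hcl', map_zero]
  have hgge : B (g * g) e = 0 := by rw [← hB.rotate, hegg]
  have hege : B (e * g) e = 0 := by rw [hB.swap h, heeg]
  have hli : LinearIndependent F ![e, g, e * e, g * g] := by
    refine linearIndependent_of_gram_triangular B ![e * e, g * g, e, g] _ ?_ ?_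
    · intro i j hij
      fin_cases i <;> fin_cases j <;>
        simp [hiso, heeg, hgge, hB.symm e (g * g)] at hij ⊢
    · intro i
      fin_cases i <;> simp [heee, hggg, hB.symm e (e * e), hB.symm g (g * g)]
  let b := basisOfLinearIndependentOfCardEqFinrank hli (by simp [hn])
  have hb : ⇑b = ![e, g, e * e, g * g] := coe_basisOfLinearIndependentOfCardEqFinrank _ _
  have heg : e * g = 0 := eq_zero_of_forall_basis hB.nondegenerate b fun i => by
    rw [hb]
    fin_cases i <;> simp [hege, hegg, hiso]
  have hspan : ∀ w, ∃ c : F, w * e = c • (e * e) := fun w => by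
    refine ⟨b.repr w 0, ?_⟩
    conv_lhs => rw [← b.sum_repr w]
    simp [hb, Fin.sum_univ_four, add_mul, smul_mul_assoc, hcl, h.mul_comm g e, heg]
  have hemem : e ∈ Submodule.span F {e, e * e} := Submodule.subset_span (by simp)
  have heemem : e * e ∈ Submodule.span F {e, e * e} := Submodule.subset_span (by simp)
  have sep : ∀ x ∈ Submodule.span F {e, e * e}, B x e = 0 → B x (e * e) = 0 → x = 0 := by
    intro x hx h1 h2
    obtain ⟨s, t, rfl⟩ := Submodule.mem_span_pair.1 hx
    have hs : s = 0 := by simpa [hiso, hB.symm e (e * e), heee] using h2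
    have ht : t = 0 := by simpa [hs, heee] using h1
    rw [hs, ht, zero_smul, zero_smul, zero_add]
  have hideal : IsAlgebraIdeal (Submodule.span F {e, e * e}) := by
    intro x y hy
    rw [h.mul_comm y x, and_self]
    obtain ⟨s, t, rfl⟩ := Submodule.mem_span_pair.1 hy
    obtain ⟨c, hc⟩ := hspan x
    rw [mul_add, mul_smul_comm, mul_smul_comm, hcl', smul_zero, add_zero, hc]
    exact Submodule.smul_mem _ _ (Submodule.smul_mem _ _ heemem)
  rcases hind.2 _ hideal ⟨fun x hx => Subtype.ext (sep x x.2 (hx ⟨e, hemem⟩) (hx ⟨_, heemem⟩)),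
      fun x hx => Subtype.ext (sep x x.2 (by rw [hB.symm]; exact hx ⟨e, hemem⟩)
        (by rw [hB.symm]; exact hx ⟨_, heemem⟩))⟩ with h1 | h1
  · rw [h1, Submodule.mem_bot] at hemem
    rw [hemem] at heee
    simp at heee
  · have hg : g ∈ Submodule.span F {e, e * e} := by rw [h1]; trivial
    obtain ⟨s, t, hst⟩ := Submodule.mem_span_pair.1 hg
    apply hggg
    have := congrArg (B (g * g)) hst
    rw [← this]
    simp [hiso, hgge]

variable [Module.Finite F J] [IsAlgClosed F]

/-- In dimension four the cubic form has a zero outside the annihilator. -/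
theorem exists_cubic_eq_zero (hB : IsPseudoEuclideanForm B) (h : IsJacobiJordan J)
    (h2 : (2 : F) ≠ 0) (h3 : (3 : F) ≠ 0) (hnt : HasNontrivialProduct J)
    (hn : 2 * finrank F (LinearMap.ker (LinearMap.mul F J)) = 4) (hn' : finrank F J = 4) :
    ∃ x : J, B (x * x) x = 0 ∧ ∃ w, x * w ≠ 0 := by
  obtain ⟨e, he⟩ := hB.exists_cubic_ne_zero h h2 h3 hnt
  -- The kernel of `B (e * e)` has dimension at least 3, while the annihilator has dimension 2.
  -- Choosing `y` there removes the quadratic term from the cubic form at `y + s e`.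
  obtain ⟨y, hy, hyA⟩ : ∃ y ∈ LinearMap.ker (B (e * e)), y ∉ LinearMap.ker (LinearMap.mul F J) := by
    rw [← SetLike.not_le_iff_exists]
    intro hle
    have h1 := Submodule.finrank_mono hle
    have h4 := (B (e * e)).finrank_range_add_finrank_ker
    have h5 := Submodule.finrank_le (LinearMap.range (B (e * e)))
    rw [finrank_self] at h5
    omega
  rw [LinearMap.mem_ker] at hy
  obtain ⟨s, hs⟩ := IsAlgClosed.exists_root (Polynomial.C (B (e * e) e) * Polynomial.X ^ 3 +
    Polynomial.C (3 * B (y * y) e) * Polynomial.X + Polynomial.C (B (y * y) y)) (by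
      rw [show Polynomial.degree (Polynomial.C (B (e * e) e) * Polynomial.X ^ 3 +
        Polynomial.C (3 * B (y * y) e) * Polynomial.X + Polynomial.C (B (y * y) y)) = 3 by
          compute_degree!]
      decide)
  have hye : B (y * e) y = B (y * y) e := hB.swap h _ _ _
  have hye' : B (y * e) e = 0 := by rw [hB.rotate, hy]
  refine ⟨y + s • e, ?_, ?_⟩
  · simp [Polynomial.IsRoot] at hs
    simp only [mul_add, add_mul, smul_mul_assoc, mul_smul_comm, map_add, map_smul,
      LinearMap.add_apply, LinearMap.smul_apply, smul_eq_mul, h.mul_comm e y, hye, hye', hy]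
    linear_combination hs
  · by_contra! hcon
    have h1 : B (e * e) (y + s • e) = 0 := by
      rw [hB.rotate, h.mul_comm, hcon, map_zero, LinearMap.zero_apply]
    have hs0 : s = 0 := by simpa [hy, he] using h1
    apply hyA
    rw [LinearMap.mem_ker, LinearMap.ext_iff]
    intro w
    simpa [hs0] using hcon w

/-- Nontrivial indecomposable pseudo-euclidean Jacobi-Jordan algebras of dimension at most
five. -/
theorem isometricallyIsomorphic_J12_or_J14 (hB : IsPseudoEuclideanForm B)
    (h : IsJacobiJordan J) (h2 : (2 : F) ≠ 0) (h3 : (3 : F) ≠ 0) (hnt : HasNontrivialProduct J)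
    (hn : finrank F J ≤ 5) (hind : IsIndecomposable B) :
    IsometricallyIsomorphic B (J12.pseudoEuclideanForm F) ∨
      IsometricallyIsomorphic B (J14.pseudoEuclideanForm F) := by
  have hcl := hB.mul_mul_eq_zero h h2 h3 hn
  have hcl' : ∀ x y z : J, x * (y * z) = 0 := fun x y z => by rw [h.mul_comm, hcl]
  have hiso : ∀ x y z t : J, B (x * y) (z * t) = 0 := fun x y z t => by
    rw [hB.invariant, hcl', map_zero]
  have hdim := hB.finrank_eq_two_mul h h2 hnt hind hcl
  have := hind.1
  have hpos := finrank_pos (R := F) (M := J)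
  obtain hk | hk : finrank F J = 2 ∨ finrank F J = 4 := by omega
  · left
    obtain ⟨e, he⟩ := hB.exists_cubic_ne_zero h h2 h3 hnt
    -- The cube root normalizes the cubic form to 1; the multiple of `e * e` then makes `x`
    -- isotropic.
    obtain ⟨s, hs⟩ := IsAlgClosed.exists_pow_nat_eq (B (e * e) e)⁻¹ (n := 3) (by norm_num)
    obtain ⟨x, hx⟩ : ∃ x, x = s • e + (-s * B e e / (2 * B (e * e) e)) • (e * e) := ⟨_, rfl⟩
    have hxx : x * x = (s * s) • (e * e) := by
      simp [hx, mul_add, add_mul, hcl, hcl', smul_mul_assoc, mul_smul_comm, smul_smul]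
    have b1 : B (x * x) x = 1 := by
      rw [hxx, hx]
      simp only [map_add, map_smul, LinearMap.smul_apply, hiso, smul_eq_mul, mul_zero, add_zero]
      rw [← inv_mul_cancel₀ he, ← hs]
      ring
    have b2 : B x x = 0 := by
      simp only [hx, map_add, map_smul, LinearMap.add_apply, LinearMap.smul_apply, hiso,
        smul_eq_mul, hB.symm e (e * e)]
      field_simp
      ring
    refine J12.isometricallyIsomorphic_of_generator J12.isPseudoEuclideanForm.nondegenerate hk
      h.mul_comm hcl x fun i j => ?_
    fin_cases i <;> fin_cases j <;>
      simp [J12.pseudoEuclideanForm_apply, J12.coords_basis, b1, b2, hiso, hB.symm x (x * x)]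
  · right
    obtain ⟨x, hxxx, w, hw⟩ := hB.exists_cubic_eq_zero h h2 h3 hnt (by omega) hk
    -- The case `x * x = 0` says that `x` is a multiple zero of the cubic form; as `x` does not
    -- annihilate the algebra, it is a double one, and `x` plays the role of `e₃`.
    by_cases hxx : x * x = 0
    · let S : LinearMap.BilinForm F J := B ∘ₗ LinearMap.mul F J x
      have hS : ∀ s t, S s t = B (x * s) t := fun s t => rfl
      obtain ⟨t, ht⟩ : ∃ t, S w t ≠ 0 := by
        by_contra! hcon
        exact hw (hB.nondegenerate.1 _ hcon)
      obtain ⟨y, hy⟩ := exists_diag_ne_zero h2 S (fun s t => hB.swap h x s t) ht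
      rw [hS] at hy
      have hyx : B (y * y) x = B (x * y) y := (hB.rotate x y y).symm
      have hxyx : B (x * y) x = 0 := by rw [hB.swap h, hxx, map_zero, LinearMap.zero_apply]
      obtain ⟨z, hz⟩ : ∃ z, z = y + (-B (y * y) y / (3 * B (x * y) y)) • x := ⟨_, rfl⟩
      refine hB.isometricallyIsomorphic_J14_of_cubic h h2 hk hcl (x := z) (y := x) ?_ ?_ ?_ hxxx
      · simp only [hz, mul_add, add_mul, smul_mul_assoc, mul_smul_comm, map_add, map_smul,
          LinearMap.add_apply, LinearMap.smul_apply, smul_eq_mul, h.mul_comm y x, hxyx, hyx, hxx,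
          map_zero, LinearMap.zero_apply]
        field_simp
        ring
      · rw [← hB.rotate, hz]
        simpa [mul_add, mul_smul_comm, hxx, hxyx] using hy
      · rw [hB.rotate, hxx, map_zero, LinearMap.zero_apply]
    · obtain ⟨y, hy⟩ : ∃ y, B (x * x) y ≠ 0 := by
        by_contra! hcon
        exact hxx (hB.nondegenerate.1 _ hcon)
      obtain ⟨a, ha⟩ : ∃ a, a = B (x * x) y := ⟨_, rfl⟩
      rw [← ha] at hy
      obtain ⟨z, hz⟩ : ∃ z, z = y + (-B (x * y) y / (2 * a)) • x := ⟨_, rfl⟩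
      have hxxz : B (x * x) z = a := by simp [hz, hxxx, ha]
      have hxzx : B (x * z) x = a := by rw [hB.swap h, hxxz]
      have hxzz : B (x * z) z = 0 := by
        have hxyx : B (x * y) x = a := by rw [hB.swap h, ha]
        simp only [hz, mul_add, mul_smul_comm, map_add, map_smul, LinearMap.add_apply,
          LinearMap.smul_apply, smul_eq_mul, hxxx, ← ha, hxyx]
        field_simp
        ring
      by_cases hzzz : B (z * z) z = 0
      · exact hB.isometricallyIsomorphic_J14_of_cubic h h2 hk hcl hxxx (by rwa [hxxz]) hxzz hzzz
      · exfalso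
        have hzzx : B (z * z) x = 0 := by rw [← hB.rotate, hxzz]
        -- On `s x + t z` the cubic is now `3 a s² t + B (z * z) z t³`. With this `r` the mixed
        -- terms vanish in the basis `r x + z, r x - z`, and its values there are `± 4 B (z * z) z`.
        obtain ⟨r, hr⟩ := IsAlgClosed.exists_pow_nat_eq (B (z * z) z / a) (n := 2) (by norm_num)
        have hr' : r ^ 2 * a = B (z * z) z := by rw [hr, div_mul_cancel₀ _ hy]
        have h4 : (4 : F) * B (z * z) z ≠ 0 := by
          have : (4 : F) = 2 * 2 := by norm_num
          rw [this]; exact mul_ne_zero (mul_ne_zero h2 h2) hzzz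
        refine hB.not_isIndecomposable_of_cubic h hk hcl (e := r • x + z) (g := r • x - z)
          ?_ ?_ ?_ ?_ hind
        all_goals
          simp only [mul_add, add_mul, mul_sub, sub_mul, smul_mul_assoc, mul_smul_comm, map_add,
            map_sub, map_smul, LinearMap.add_apply, LinearMap.sub_apply, LinearMap.smul_apply,
            smul_eq_mul, h.mul_comm z x, hxxx, hxxz, hxzx, hxzz, hzzx]
        · intro hcon
          exact h4 (by linear_combination hcon - 3 * hr')
        · linear_combination hr'
        · linear_combination -hr'
        · intro hcon
          exact h4 (by linear_combination -hcon - 3 * hr')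

end IsPseudoEuclideanForm

end PseudoEuclidean

theorem mainTheorem2 (F : Type u) [Field F] [IsAlgClosed F]
    (h2 : ringChar F ≠ 2) (h3 : ringChar F ≠ 3) :
    -- the two algebras are nontrivial Jacobi-Jordan algebras
    (IsJacobiJordan (J12 F) ∧ HasNontrivialProduct (J12 F)) ∧
    (IsJacobiJordan (J14 F) ∧ HasNontrivialProduct (J14 F)) ∧
    -- the symplectic case
    ((IsSymplecticForm (J14.symplecticForm F) ∧ IsIndecomposable (J14.symplecticForm F)) ∧
      ∀ (J : Type v) [NonUnitalNonAssocRing J] [Module F J] [IsScalarTower F J J]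
        [SMulCommClass F J J] [Module.Finite F J] (ω : LinearMap.BilinForm F J),
        IsJacobiJordan J → HasNontrivialProduct J → Module.finrank F J ≤ 5 →
        IsSymplecticForm ω → IsIndecomposable ω →
        IsometricallyIsomorphic ω (J14.symplecticForm F)) ∧
    -- the pseudo-euclidean case
    ((IsPseudoEuclideanForm (J12.pseudoEuclideanForm F) ∧
        IsIndecomposable (J12.pseudoEuclideanForm F)) ∧
      (IsPseudoEuclideanForm (J14.pseudoEuclideanForm F) ∧
        IsIndecomposable (J14.pseudoEuclideanForm F)) ∧
      (¬ ∃ f : J12 F ≃ₗ[F] J14 F, ∀ x y : J12 F, f (x * y) = f x * f y) ∧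
      ∀ (J : Type v) [NonUnitalNonAssocRing J] [Module F J] [IsScalarTower F J J]
        [SMulCommClass F J J] [Module.Finite F J] (B : LinearMap.BilinForm F J),
        IsJacobiJordan J → HasNontrivialProduct J → Module.finrank F J ≤ 5 →
        IsPseudoEuclideanForm B → IsIndecomposable B →
        IsometricallyIsomorphic B (J12.pseudoEuclideanForm F) ∨
          IsometricallyIsomorphic B (J14.pseudoEuclideanForm F)) := by
  have two : (2 : F) ≠ 0 := Ring.two_ne_zero h2
  have three : (3 : F) ≠ 0 := fun h => by
    have hdvd : ringChar F ∣ 3 := (ringChar.spec F 3).1 (by exact_mod_cast h)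
    rcases (Nat.dvd_prime Nat.prime_three).1 hdvd with h1 | h1
    · exact CharP.ringChar_ne_one h1
    · exact h3 h1
  refine ⟨⟨J12.isJacobiJordan, J12.hasNontrivialProduct⟩,
    ⟨J14.isJacobiJordan, J14.hasNontrivialProduct⟩,
    ⟨⟨J14.isSymplecticForm two, J14.symplecticForm_isIndecomposable two⟩, ?_⟩,
    ⟨J12.isPseudoEuclideanForm, J12.isIndecomposable⟩,
    ⟨J14.isPseudoEuclideanForm, J14.pseudoEuclideanForm_isIndecomposable⟩, ?_, ?_⟩
  · intro J _ _ _ _ _ ω hJ hnt hn hω _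
    exact hω.isometricallyIsomorphic_J14 hJ two three hnt hn
  · rintro ⟨f, -⟩
    have := f.finrank_eq
    rw [J12.finrank_eq, J14.finrank_eq] at this
    omega
  · intro J _ _ _ _ _ B hJ hnt hn hB hind
    exact hB.isometricallyIsomorphic_J12_or_J14 hJ two three hnt hn hind
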